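/- Let $m\ge 1$ be an integer and, for integers $\alpha,n\ge 0$, let $L_n^{(\alpha)}(x)=\sum_{i=0}^{n}(-1)^i\binom{n+\alpha}{n-i}\frac{x^i}{i!}$ be the Laguerre polynomials, $L_n=L_n^{(0)}$. For $\lambda>0$ let $\mathcal P(\lambda,m)$ be the generalized Poisson (photon-counting) law on $\{0,1,2,\dots\}\subset\mathbb R$ given by $$p_j(\lambda,m)=\frac{(m\wedge j)!}{(m\vee j)!}\,\lambda^{|m-j|}e^{-\lambda}\Bigl(L_{m\wedge j}^{(|m-j|)}(\lambda)\Bigr)^2,\qquad j=0,1,2,\dots,$$ where $m\wedge j=\min(m,j)$ and $m\vee j=\max(m,j)$. A law on $\mathbb R$ is called infinitely divisible if for every $n\ge 1$ it is the law of a sum of $n$ independent identically distributed real random variables. Then the following hold. The polynomial $L_m$ has exactly $m$ distinct zeros $x_1^{(m)}<\dots<x_m^{(m)}$, all real and positive. For every $\lambda>0$, $\mathcal P(\lambda,m)$ is a probability law, with characteristic function $$\varphi(u)=e^{\lambda(e^{iu}-1)}\,e^{imu}\,L_m\bigl(2\lambda(1-\cos u)\bigr),\qquad u\in\mathbb R.$$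 1. If $\lambda\ge \frac14 x_k^{(m)}$ for some $1\le k\le m$, then $\mathcal P(\lambda,m)$ is not infinitely divisible, and $\varphi(u)=0$ for some $u\in\mathbb R$. 2. If $0<\lambda<\frac14 x_1^{(m)}$, then $\mathcal P(\lambda,m)$ is not infinitely divisible. Moreover, with $P(z)=\sum_{j\ge0}p_j(\lambda,m)z^j$, the logarithmic derivative $P'/P$ has a power series expansion $\sum_{k\ge 0}r_kz^k$ near $z=0$, with $r_k<0$ for some $k$. -/

import Mathlib

open MeasureTheory

/-- The (generalized) Laguerre polynomial
`L_n^{(α)}(X) = ∑_{i=0}^{n} (-1)^i * C(n + α, n - i) * X^i / i!`, for `α` a natural number. -/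
noncomputable def laguerre (α n : ℕ) : Polynomial ℝ :=
  ∑ i ∈ Finset.range (n + 1),
    Polynomial.C ((-1 : ℝ) ^ i * ((n + α).choose (n - i) : ℝ) / (i.factorial : ℝ)) *
      Polynomial.X ^ i

/-- `x 0 < x 1 < ⋯ < x (m - 1)` are the zeros of `L_m = L_m^{(0)}`: there are exactly `m` real
zeros (hence no others, as the degree is `m`), listed in increasing order. -/
def IsOrderedLaguerreZeros (m : ℕ) (x : Fin m → ℝ) : Prop :=
  StrictMono x ∧ ∀ t : ℝ, (laguerre 0 m).eval t = 0 ↔ ∃ k, x k = t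

/-- The probability of counting `j` photons,
`p_j(lam, m) = (m ∧ j)! / (m ∨ j)! * lam ^ |m - j| * e^{-lam} * (L_{m ∧ j}^{(|m - j|)}(lam))²`. -/
noncomputable def genPoissonProb (lam : ℝ) (m j : ℕ) : ℝ :=
  ((min m j).factorial : ℝ) / ((max m j).factorial : ℝ) * lam ^ (max m j - min m j) *
    Real.exp (-lam) * ((laguerre (max m j - min m j) (min m j)).eval lam) ^ 2

/-- The generalized Poisson law, as a measure on the real line:
`∑_{j ≥ 0} p_j(lam, m) δ_j`. -/
noncomputable def genPoissonLaw (lam : ℝ) (m : ℕ) : Measure ℝ :=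
  Measure.sum fun j : ℕ => ENNReal.ofReal (genPoissonProb lam m j) • Measure.dirac (j : ℝ)

/-- The probability generating function `P(z) = ∑_{j ≥ 0} p_j(lam, m) z^j`. -/
noncomputable def genPoissonPGF (lam : ℝ) (m : ℕ) (z : ℝ) : ℝ :=
  ∑' j : ℕ, genPoissonProb lam m j * z ^ j

/-- A law `μ` on the real line is infinitely divisible if for every `n ≥ 1` it is the law of a sum
`Y_1 + ⋯ + Y_n` of independent real random variables with a common law `ν` (the joint law of
`(Y_1, …, Y_n)` is the product measure `ν ⊗ ⋯ ⊗ ν`). -/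
def IsInfinitelyDivisible (μ : Measure ℝ) : Prop :=
  ∀ n : ℕ, 1 ≤ n → ∃ ν : Measure ℝ, IsProbabilityMeasure ν ∧
    (Measure.pi fun _ : Fin n => ν).map (fun y => ∑ k, y k) = μ

/-! Write each Laguerre value in the photon weights as a Charlier polynomial, symmetric in `m` and
`j`. Squaring it and linearizing products of falling factorials sums the generating function in
closed form (`hasSum_genPoissonProb_mul_pow`). At z = 1 this gives total mass 1; at z = e^{iu} it
gives the characteristic function. The zeros of `L_m` come from Rolle's theorem, by induction on the
degree with the parameter `a` varying. If λ ≥ x_k/4, the equation 2λ(1 - cos u) = x_k is solvable,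
so φ vanishes somewhere. This excludes infinite divisibility by
`IsInfinitelyDivisible.charFun_ne_zero`. If λ < x_1/4, φ may have no zeros, and the obstruction lies
in the first three weights. By Vieta the zeros sum to m², so x_1 ≤ m and λ < m/4. Then p_1² -
2p_0p_2 is a positive multiple of 2(λ - m)² - m > 0, so r_1 < 0. On the other hand, p_1² ≤ 2p_0p_2
for every infinitely divisible law on ℕ that charges 0
(`IsInfinitelyDivisible.sq_measureReal_one_le`), as elementary bounds on the n-th convolution roots
show when n → ∞. -/

/-! ### Laguerre polynomials and their zeros -/

lemma laguerre_coeff (a k i : ℕ) : (laguerre a k).coeff i =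
    if i ≤ k then (-1 : ℝ) ^ i * ((k + a).choose (k - i) : ℝ) / (i.factorial : ℝ) else 0 := by
  simp only [laguerre, Polynomial.finsetSum_coeff, Polynomial.coeff_C_mul, Polynomial.coeff_X_pow,
    mul_ite, mul_one, mul_zero, Finset.sum_ite_eq, Finset.mem_range, Nat.lt_succ_iff]

lemma laguerre_eval (a k : ℕ) (t : ℝ) : (laguerre a k).eval t = ∑ i ∈ Finset.range (k + 1),
    (-1 : ℝ) ^ i * ((k + a).choose (k - i) : ℝ) / (i.factorial : ℝ) * t ^ i := by
  simp [laguerre, Polynomial.eval_finsetSum]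

lemma natDegree_laguerre (a k : ℕ) : (laguerre a k).natDegree = k := by
  refine Polynomial.natDegree_eq_of_le_of_coeff_ne_zero ?_ ?_
  · rw [Polynomial.natDegree_le_iff_coeff_eq_zero]
    intro i hi
    rw [laguerre_coeff, if_neg (by omega)]
  · rw [laguerre_coeff, if_pos le_rfl]
    simp [Nat.factorial_ne_zero]

/-- `d/dx (x^{a+1} L_k^{(a+1)} e^{-x}) = (k+1) x^a L_{k+1}^{(a)} e^{-x}`, at the level of
polynomials. -/
lemma laguerre_succ (a k : ℕ) :
    Polynomial.C ((a : ℝ) + 1) * laguerre (a + 1) k +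
      Polynomial.X * (Polynomial.derivative (laguerre (a + 1) k) - laguerre (a + 1) k) =
    Polynomial.C ((k : ℝ) + 1) * laguerre a (k + 1) := by
  ext i
  rcases i with _ | i
  · simp only [Polynomial.coeff_add, Polynomial.mul_coeff_zero, Polynomial.coeff_C_zero,
      Polynomial.coeff_X_zero, zero_mul, add_zero, laguerre_coeff]
    have h2 := Nat.choose_succ_right_eq (k + 1 + a) k
    rw [show k + 1 + a - k = a + 1 by omega] at h2
    simp only [Nat.zero_le, if_true, pow_zero, one_mul, Nat.sub_zero, Nat.factorial_zero,
      Nat.cast_one, div_one]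
    rw [show k + (a + 1) = k + 1 + a by ring]
    have h3 : (((k + 1 + a).choose (k + 1) * (k + 1) : ℕ) : ℝ)
      = (((k + 1 + a).choose k * (a + 1) : ℕ) : ℝ) := by rw [h2]
    push_cast at h3
    linarith
  · simp only [Polynomial.coeff_add, Polynomial.coeff_C_mul, Polynomial.coeff_X_mul,
      Polynomial.coeff_sub, Polynomial.coeff_derivative, laguerre_coeff]
    rcases lt_trichotomy i k with h | h | h
    · rw [if_pos (by omega), if_pos (by omega), if_pos (by omega)]
      obtain ⟨d, rfl⟩ : ∃ d, k = i + 1 + d := ⟨k - i - 1, by omega⟩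
      rw [show i + 1 + d - (i + 1) = d by omega, show i + 1 + d - i = d + 1 by omega,
        show i + 1 + d + 1 - (i + 1) = d + 1 by omega,
        show i + 1 + d + (a + 1) = i + d + a + 2 by ring,
        show i + 1 + d + 1 + a = i + d + a + 2 by ring]
      have h2 := Nat.choose_succ_right_eq (i + d + a + 2) d
      rw [show i + d + a + 2 - d = i + a + 2 by omega] at h2
      have h3 : (((i + d + a + 2).choose (d + 1) * (d + 1) : ℕ) : ℝ)
        = (((i + d + a + 2).choose d * (i + a + 2) : ℕ) : ℝ) := by rw [h2]
      push_cast at h3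
      rw [Nat.factorial_succ]
      have := Nat.factorial_ne_zero i
      push_cast
      field_simp
      rw [pow_succ]
      linear_combination (-1 : ℝ) ^ i * h3
    · subst h
      rw [if_neg (by omega), if_pos (by omega), if_pos (by omega)]
      simp only [Nat.sub_self, Nat.choose_zero_right, Nat.factorial_succ]
      have := Nat.factorial_ne_zero i
      push_cast
      field_simp
      ring
    · rw [if_neg (by omega), if_neg (by omega), if_neg (by omega)]
      simp

/-- On t > 0 the critical points of the weighted polynomial are thus zeros of the next Laguerre
polynomial, which is what Rolle's theorem needs. -/
lemma hasDerivAt_laguerre_weight (a k : ℕ) (t : ℝ) :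
    HasDerivAt (fun t => t ^ (a + 1) * (laguerre (a + 1) k).eval t * Real.exp (-t))
      ((k + 1) * (t ^ a * (laguerre a (k + 1)).eval t * Real.exp (-t))) t := by
  have h1 : HasDerivAt (fun t => t ^ (a + 1) * (laguerre (a + 1) k).eval t * Real.exp (-t))
      (((↑(a + 1) * t ^ a) * (laguerre (a + 1) k).eval t +
        t ^ (a + 1) * (Polynomial.derivative (laguerre (a + 1) k)).eval t) * Real.exp (-t) +
        t ^ (a + 1) * (laguerre (a + 1) k).eval t * (Real.exp (-t) * -1)) t :=
    ((hasDerivAt_pow (a + 1) t).mul ((laguerre (a + 1) k).hasDerivAt t)).mul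
      (hasDerivAt_id t).neg.exp
  refine h1.congr_deriv ?_
  have h := congrArg (Polynomial.eval t) (laguerre_succ a k)
  simp only [Polynomial.eval_add, Polynomial.eval_mul, Polynomial.eval_C, Polynomial.eval_X,
    Polynomial.eval_sub] at h
  push_cast
  linear_combination (t ^ a * Real.exp (-t)) * h

/-- Rolle's theorem on a half-line, for a function that vanishes at the end point and at
infinity. -/
lemma exists_deriv_eq_zero_of_tendsto_zero {f : ℝ → ℝ} {a : ℝ} (hf : Continuous f) (ha : f a = 0)
    (hlim : Filter.Tendsto f Filter.atTop (nhds 0)) : ∃ c, a < c ∧ deriv f c = 0 := by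
  wlog hpos : 0 ≤ f (a + 1) generalizing f
  · obtain ⟨c, hc, h⟩ := this (f := fun t => -f t) hf.neg (by simp [ha]) (by simpa using hlim.neg)
      (by linarith)
    refine ⟨c, hc, ?_⟩
    rw [deriv.fun_neg] at h
    linarith
  rcases hpos.eq_or_lt with h0 | h0
  · obtain ⟨c, hc, h⟩ := exists_deriv_eq_zero (f := f) (show a < a + 1 by linarith)
      hf.continuousOn (by rw [ha, h0])
    exact ⟨c, hc.1, h⟩
  -- Choose b far out with f b < f (a + 1). If f b ≤ 0, f has a second zero; otherwise f already
  -- takes the value f b on [a, a + 1].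
  · obtain ⟨b, hb, hb1⟩ := ((hlim.eventually_lt_const h0).and
      (Filter.eventually_gt_atTop (a + 1))).exists
    by_cases hb0 : f b ≤ 0
    · obtain ⟨s, hs, hs0⟩ := intermediate_value_Icc' hb1.le hf.continuousOn ⟨hb0, h0.le⟩
      obtain ⟨c, hc, h⟩ := exists_deriv_eq_zero (f := f) (show a < s by linarith [hs.1])
        hf.continuousOn (by rw [ha, hs0])
      exact ⟨c, hc.1, h⟩
    · obtain ⟨s, hs, hs0⟩ := intermediate_value_Icc (show a ≤ a + 1 by linarith)
        hf.continuousOn (show f b ∈ _ from ⟨by rw [ha]; linarith, hb.le⟩)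
      obtain ⟨c, hc, h⟩ := exists_deriv_eq_zero (f := f) (show s < b by linarith [hs.2])
        hf.continuousOn hs0
      exact ⟨c, by linarith [hs.1, hc.1], h⟩

lemma tendsto_pow_mul_eval_mul_exp_neg (n : ℕ) (p : Polynomial ℝ) :
    Filter.Tendsto (fun t => t ^ n * p.eval t * Real.exp (-t)) Filter.atTop (nhds 0) := by
  have h := Polynomial.tendsto_div_exp_atTop (Polynomial.X ^ n * p)
  refine h.congr fun t => ?_
  simp [Real.exp_neg, div_eq_mul_inv]

/-- Induction lowers the parameter while raising the degree: the weight for `(a + 1, k)` vanishes at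
0, at k positive points and at infinity, which leaves k + 1 gaps for Rolle. The entry `x 0 = 0` is
the origin, not a Laguerre zero. -/
lemma exists_zeros_laguerre (k : ℕ) : ∀ a : ℕ, ∃ x : ℕ → ℝ, x 0 = 0 ∧
    (∀ i < k, x i < x (i + 1)) ∧ ∀ i < k, (laguerre a k).eval (x (i + 1)) = 0 := by
  induction k with
  | zero => exact fun a => ⟨fun _ => 0, rfl, by simp, by simp⟩
  | succ k ih =>
    intro a
    obtain ⟨x, hx0, hlt, hz⟩ := ih (a + 1)
    set f : ℝ → ℝ := fun t => t ^ (a + 1) * (laguerre (a + 1) k).eval t * Real.exp (-t) with hf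
    have hfc : Continuous f := by
      rw [hf]
      exact ((continuous_pow _).mul (Polynomial.continuous _)).mul
        (Real.continuous_exp.comp continuous_neg)
    have hfx : ∀ i ≤ k, f (x i) = 0 := by
      intro i hi
      rcases i with _ | i
      · simp [hf, hx0]
      · simp [hf, hz i hi]
    have hnn : ∀ i ≤ k, 0 ≤ x i := by
      intro i
      induction i with
      | zero => intro _; rw [hx0]
      | succ i ihi => intro hi; exact (ihi (by omega)).trans (hlt i hi).le
    have hd : ∀ t, 0 < t → deriv f t = 0 → (laguerre a (k + 1)).eval t = 0 := by
      intro t ht h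
      rw [(hasDerivAt_laguerre_weight a k t).deriv] at h
      have h1 := pow_pos ht a
      have h2 := Real.exp_pos (-t)
      have h3 : (0 : ℝ) < k + 1 := by positivity
      simpa [h1.ne', h2.ne', h3.ne'] using h
    have key : ∀ i, ∃ y, i ≤ k → x i < y ∧ (i < k → y < x (i + 1)) ∧
        (laguerre a (k + 1)).eval y = 0 := by
      intro i
      by_cases hi : i ≤ k
      · rcases hi.lt_or_eq with h | h
        · obtain ⟨c, hc, hc'⟩ := exists_deriv_eq_zero (hlt i h) hfc.continuousOn
            (by rw [hfx i hi, hfx (i + 1) h])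
          exact ⟨c, fun _ => ⟨hc.1, fun _ => hc.2, hd c ((hnn i hi).trans_lt hc.1) hc'⟩⟩
        · obtain ⟨c, hc, hc'⟩ := exists_deriv_eq_zero_of_tendsto_zero hfc (hfx i hi)
            (tendsto_pow_mul_eval_mul_exp_neg _ _)
          exact ⟨c, fun _ => ⟨hc, fun h' => absurd h' (by omega),
            hd c ((hnn i hi).trans_lt hc) hc'⟩⟩
      · exact ⟨0, fun h => absurd h hi⟩
    choose y hy using key
    refine ⟨fun i => Nat.casesOn i 0 y, rfl, ?_, ?_⟩
    · intro i hi
      rcases i with _ | i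
      · have := (hy 0 (by omega)).1
        rwa [hx0] at this
      · exact ((hy i (by omega)).2.1 (by omega)).trans (hy (i + 1) (by omega)).1
    · intro i hi
      exact (hy i (by omega)).2.2

/-- The m distinct zeros exhaust the degree, so all are simple; this is what allows Vieta's formula.
-/
lemma IsOrderedLaguerreZeros.roots_eq {m : ℕ} {x : Fin m → ℝ} (hx : IsOrderedLaguerreZeros m x) :
    (laguerre 0 m).roots = Finset.univ.val.map x := by
  have hne : laguerre 0 m ≠ 0 := by
    intro h
    have := laguerre_coeff 0 m 0
    rw [h] at this
    simp at this
  symm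
  refine Multiset.eq_of_le_of_card_le ?_ ?_
  · rw [Multiset.le_iff_subset (Multiset.Nodup.map hx.1.injective Finset.univ.nodup)]
    intro t ht
    rw [Multiset.mem_map] at ht
    obtain ⟨k, -, hk⟩ := ht
    rw [Polynomial.mem_roots hne]
    exact (hx.2 t).2 ⟨k, hk⟩
  · refine (Polynomial.card_roots' _).trans ?_
    simp [natDegree_laguerre]

lemma exists_isOrderedLaguerreZeros (m : ℕ) :
    ∃ x : Fin m → ℝ, IsOrderedLaguerreZeros m x ∧ ∀ k, 0 < x k := by
  obtain ⟨x, hx0, hlt, hz⟩ := exists_zeros_laguerre m 0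
  have hmono : StrictMonoOn x (Set.Iic m) := by
    refine strictMonoOn_of_lt_add_one Set.ordConnected_Iic ?_
    intro i _ hi hi'
    exact hlt i (by simpa using hi')
  have hpos : ∀ k : Fin m, 0 < x (k + 1) := by
    intro k
    rw [← hx0]
    exact hmono (by simp) (by simp) (by omega)
  have hsm : StrictMono fun k : Fin m => x (k + 1) := by
    intro i j hij
    exact hmono (by simp) (by simp) (by simpa using hij)
  have hne : laguerre 0 m ≠ 0 := by
    intro h
    have := laguerre_coeff 0 m 0
    rw [h] at this
    simp at this
  refine ⟨fun k => x (k + 1), ⟨hsm, fun t => ⟨fun ht => ?_, ?_⟩⟩, hpos⟩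
  · have hsub : Finset.univ.image (fun k : Fin m => x (k + 1)) ⊆ (laguerre 0 m).roots.toFinset := by
      intro s hs
      simp only [Finset.mem_image, Finset.mem_univ, true_and] at hs
      obtain ⟨k, rfl⟩ := hs
      rw [Multiset.mem_toFinset, Polynomial.mem_roots hne]
      exact hz k k.2
    have heq := Finset.eq_of_subset_of_card_le hsub (by
      rw [Finset.card_image_of_injective _ hsm.injective, Finset.card_univ, Fintype.card_fin]
      refine (Multiset.toFinset_card_le _).trans ((Polynomial.card_roots' _).trans ?_)
      rw [natDegree_laguerre])
    have : t ∈ (laguerre 0 m).roots.toFinset := by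
      rw [Multiset.mem_toFinset, Polynomial.mem_roots hne]
      exact ht
    rw [← heq] at this
    simpa using this
  · rintro ⟨k, rfl⟩
    exact hz k k.2

lemma IsOrderedLaguerreZeros.pos {m : ℕ} {x : Fin m → ℝ} (hx : IsOrderedLaguerreZeros m x)
    (k : Fin m) : 0 < x k := by
  obtain ⟨y, hy, hpos⟩ := exists_isOrderedLaguerreZeros m
  obtain ⟨j, hj⟩ := (hy.2 _).1 ((hx.2 (x k)).2 ⟨k, rfl⟩)
  exact hj ▸ hpos j

/-- Vieta: the top two coefficients are (-1)^m / m! and (-1)^(m-1) m / (m-1)!. -/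
lemma IsOrderedLaguerreZeros.sum_eq {m : ℕ} (hm : 1 ≤ m) {x : Fin m → ℝ}
    (hx : IsOrderedLaguerreZeros m x) : ∑ k, x k = (m : ℝ) ^ 2 := by
  have hs : (laguerre 0 m).Splits := by
    rw [Polynomial.splits_iff_card_roots, hx.roots_eq, natDegree_laguerre]
    simp
  have h := hs.nextCoeff_eq_neg_sum_roots_mul_leadingCoeff
  obtain ⟨n, rfl⟩ : ∃ n, m = n + 1 := ⟨m - 1, by omega⟩
  rw [Polynomial.nextCoeff_of_natDegree_pos (by rw [natDegree_laguerre]; omega), hx.roots_eq,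
    Polynomial.leadingCoeff, natDegree_laguerre, laguerre_coeff, laguerre_coeff,
    if_pos le_rfl, if_pos (by omega)] at h
  change _ = _ * ∑ k, x k at h
  rw [show n + 1 - (n + 1 - 1) = 1 by omega] at h
  simp only [add_zero, Nat.sub_self, Nat.choose_one_right, Nat.choose_zero_right,
    Nat.add_sub_cancel, Nat.factorial_succ] at h
  have := Nat.factorial_ne_zero n
  push_cast at h ⊢
  rw [pow_succ] at h
  have h1 : ((-1 : ℝ) ^ n) ≠ 0 := by simp
  field_simp at h
  linarith

lemma IsOrderedLaguerreZeros.first_le {m : ℕ} (hm : 1 ≤ m) {x : Fin m → ℝ}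
    (hx : IsOrderedLaguerreZeros m x) : x ⟨0, hm⟩ ≤ m := by
  have h : ∑ _k : Fin m, x ⟨0, hm⟩ ≤ ∑ k, x k :=
    Finset.sum_le_sum fun k _ => hx.1.monotone (by simp [Fin.le_def])
  rw [hx.sum_eq hm] at h
  simp only [Finset.sum_const, Finset.card_univ, Fintype.card_fin, nsmul_eq_mul] at h
  have : (0 : ℝ) < m := by exact_mod_cast hm
  nlinarith

/-! ### Charlier polynomials and the closed form of the generating function -/

/-- The Charlier polynomial `C_m(j; lam)`, symmetric in `m` and `j`. -/
noncomputable def charlier (lam : ℝ) (m j : ℕ) : ℝ :=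
  ∑ i ∈ Finset.range (m + 1), (m.choose i : ℝ) * (j.choose i : ℝ) * (i.factorial : ℝ) *
    (-lam⁻¹) ^ i

lemma charlier_eq_sum_range_of_le (lam : ℝ) {m j N : ℕ} (hN : m ≤ N) : charlier lam m j =
    ∑ i ∈ Finset.range (N + 1), (m.choose i : ℝ) * (j.choose i : ℝ) * (i.factorial : ℝ) *
      (-lam⁻¹) ^ i := by
  refine Finset.sum_subset (Finset.range_mono (by omega)) fun i _ hi => ?_
  rw [Nat.choose_eq_zero_of_lt (by simpa using hi)]
  simp

lemma charlier_comm (lam : ℝ) (m j : ℕ) : charlier lam m j = charlier lam j m := by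
  rw [charlier_eq_sum_range_of_le lam (le_max_left m j),
    charlier_eq_sum_range_of_le lam (le_max_right m j)]
  exact Finset.sum_congr rfl fun i _ => by ring

/-- Reversing the order of summation matches the two sums term by term. The Charlier form removes
`min` and `max` from the weights. -/
lemma laguerre_eval_eq_charlier {lam : ℝ} (hlam : lam ≠ 0) {a b : ℕ} (hab : a ≤ b) :
    (laguerre (b - a) a).eval lam = (-lam) ^ a / (a.factorial : ℝ) * charlier lam a b := by
  rw [laguerre_eval, charlier, Finset.mul_sum, ← Finset.sum_flip]
  refine Finset.sum_congr rfl fun s hs => ?_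
  have hs : s ≤ a := by simpa [Nat.lt_succ_iff] using hs
  rw [Nat.sub_sub_self hs, Nat.add_sub_cancel' hab]
  obtain ⟨d, rfl⟩ := Nat.exists_eq_add_of_le hs
  rw [Nat.add_sub_cancel_left]
  have h := Nat.choose_mul_factorial_mul_factorial (Nat.le_add_right s d)
  rw [Nat.add_sub_cancel_left] at h
  have h' : ((s + d).choose s : ℝ) * s.factorial * d.factorial = (s + d).factorial := by
    exact_mod_cast h
  have h1 := Nat.factorial_ne_zero d
  have h2 : ((s + d).factorial : ℝ) ≠ 0 := by exact_mod_cast Nat.factorial_ne_zero (s + d)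
  have h3 : (-lam) ^ (s + d) * (-lam⁻¹) ^ s = (-1) ^ d * lam ^ d := by
    rw [pow_add, mul_right_comm, ← mul_pow, ← mul_pow]
    simp [hlam]
  calc _ = ((-1) ^ d * lam ^ d) * ((b.choose s : ℝ) / d.factorial) := by ring
    _ = ((-lam) ^ (s + d) * (-lam⁻¹) ^ s) * ((b.choose s : ℝ) *
        (((s + d).choose s : ℝ) * s.factorial) / (s + d).factorial) := by
      rw [h3, ← h']
      have h4 : ((s + d).choose s : ℝ) ≠ 0 := by
        exact_mod_cast (Nat.choose_pos (by omega)).ne'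
      have h5 := Nat.factorial_ne_zero s
      field_simp
    _ = _ := by ring

lemma genPoissonProb_eq {lam : ℝ} (hlam : lam ≠ 0) (m j : ℕ) : genPoissonProb lam m j =
    Real.exp (-lam) * lam ^ (m + j) / ((m.factorial : ℝ) * (j.factorial : ℝ)) *
      charlier lam m j ^ 2 := by
  have key : ∀ a b : ℕ, a ≤ b → (a.factorial : ℝ) / (b.factorial : ℝ) * lam ^ (b - a) *
      Real.exp (-lam) * ((laguerre (b - a) a).eval lam) ^ 2 =
      Real.exp (-lam) * lam ^ (a + b) / ((a.factorial : ℝ) * (b.factorial : ℝ)) *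
      charlier lam a b ^ 2 := by
    intro a b hab
    rw [laguerre_eval_eq_charlier hlam hab, mul_pow, div_pow, ← pow_mul, mul_comm a 2, pow_mul,
      neg_sq, ← pow_mul]
    have h1 := Nat.factorial_ne_zero a
    have h2 := Nat.factorial_ne_zero b
    obtain ⟨d, rfl⟩ := Nat.exists_eq_add_of_le hab
    rw [Nat.add_sub_cancel_left]
    field_simp
    ring
  unfold genPoissonProb
  rw [key _ _ min_le_max]
  rcases le_total m j with h | h
  · rw [min_eq_left h, max_eq_right h]
  · rw [min_eq_right h, max_eq_left h, charlier_comm]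
    ring

lemma genPoissonProb_nonneg {lam : ℝ} (hlam : 0 < lam) (m j : ℕ) : 0 ≤ genPoissonProb lam m j := by
  rw [genPoissonProb_eq hlam.ne']
  positivity

/-- Linearization of a product of falling factorials. -/
lemma descFactorial_mul_descFactorial_eq_sum {i l M : ℕ} (hl : l ≤ M) (j : ℕ) :
    j.descFactorial i * j.descFactorial l = ∑ r ∈ Finset.range (M + 1),
      i.choose r * l.choose r * r.factorial * j.descFactorial (i + l - r) := by
  have hsub : ∑ r ∈ Finset.range (M + 1),
      i.choose r * l.choose r * r.factorial * j.descFactorial (i + l - r) =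
      ∑ r ∈ Finset.range (l + 1),
      i.choose r * l.choose r * r.factorial * j.descFactorial (i + l - r) := by
    symm
    refine Finset.sum_subset (Finset.range_mono (by omega)) fun r _ hr => ?_
    rw [Nat.choose_eq_zero_of_lt (show l < r by simpa using hr)]
    simp
  rw [hsub]
  rcases lt_or_ge j i with hji | hji
  · rw [Nat.descFactorial_of_lt hji, zero_mul]
    symm
    refine Finset.sum_eq_zero fun r hr => ?_
    have : r ≤ l := by simpa [Nat.lt_succ_iff] using hr
    rw [Nat.descFactorial_of_lt (show j < i + l - r by omega), mul_zero]
  · obtain ⟨d, rfl⟩ := Nat.exists_eq_add_of_le hji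
    rw [Nat.descFactorial_eq_factorial_mul_choose (i + d) l, Nat.add_choose_eq,
      Finset.Nat.sum_antidiagonal_eq_sum_range_succ (fun a b => i.choose a * d.choose b),
      Finset.mul_sum, Finset.mul_sum]
    refine Finset.sum_congr rfl fun r hr => ?_
    have hr : r ≤ l := by simpa [Nat.lt_succ_iff] using hr
    have h1 := Nat.descFactorial_mul_descFactorial (n := i + d) (k := i) (m := i + l - r) (by omega)
    rw [Nat.add_sub_cancel_left, show i + l - r - i = l - r by omega,
      Nat.descFactorial_eq_factorial_mul_choose d] at h1
    rw [← h1, ← Nat.choose_mul_factorial_mul_factorial hr]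
    ring

lemma hasSum_descFactorial_mul_pow_div_factorial (i : ℕ) (w : ℂ) :
    HasSum (fun j : ℕ => (j.descFactorial i : ℂ) * (w ^ j / (j.factorial : ℂ)))
      (w ^ i * Complex.exp w) := by
  rw [← hasSum_nat_add_iff' i, Finset.sum_eq_zero, sub_zero]
  · have h : HasSum (fun j : ℕ => w ^ j / (j.factorial : ℂ)) (Complex.exp w) := by
      rw [Complex.exp_eq_exp_ℂ]
      exact NormedSpace.expSeries_div_hasSum_exp w
    refine (h.mul_left (w ^ i)).congr_fun fun j => ?_
    have h1 : j.factorial * (j + i).descFactorial i = (j + i).factorial := by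
      have := Nat.factorial_mul_descFactorial (show i ≤ j + i by omega)
      rwa [Nat.add_sub_cancel] at this
    rw [← h1]
    have h2 := Nat.factorial_ne_zero j
    have h3 : (j + i).descFactorial i ≠ 0 := fun h => by simp at h
    push_cast
    field_simp
    ring
  · intro j hj
    rw [Nat.descFactorial_of_lt (by simpa using hj)]
    simp

/-- Terms with i < r vanish; C(m,i) C(i,r) = C(m,r) C(m-r,i-r) reduces the rest to the binomial
theorem. -/
lemma sum_choose_mul_choose_mul_pow {lam : ℂ} (hlam : lam ≠ 0) (z : ℂ) {m r : ℕ} (hr : r ≤ m) :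
    ∑ i ∈ Finset.range (m + 1), (m.choose i : ℂ) * (i.choose r : ℂ) * (-lam⁻¹) ^ i *
      (lam * z) ^ (i - r) = (-lam⁻¹) ^ r * (m.choose r : ℂ) * (1 - z) ^ (m - r) := by
  obtain ⟨d, rfl⟩ := Nat.exists_eq_add_of_le hr
  rw [add_assoc, Finset.sum_range_add, Finset.sum_eq_zero, zero_add, Nat.add_sub_cancel_left,
    show (1 - z) = -z + 1 by ring, add_pow, Finset.mul_sum]
  · refine Finset.sum_congr rfl fun k hk => ?_
    have hk : k ≤ d := by simpa [Nat.lt_succ_iff] using hk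
    have h := Nat.choose_mul (n := r + d) (k := r + k) (s := r) (by omega)
    rw [Nat.add_sub_cancel_left, Nat.add_sub_cancel_left] at h
    have h' : ((r + d).choose (r + k) : ℂ) * ((r + k).choose r : ℂ) =
      ((r + d).choose r : ℂ) * (d.choose k : ℂ) := by exact_mod_cast h
    rw [h', Nat.add_sub_cancel_left, pow_add, one_pow]
    have h2 : (-lam⁻¹) ^ k * (lam * z) ^ k = (-z) ^ k := by
      rw [← mul_pow]
      congr 1
      field_simp
    linear_combination ((r + d).choose r : ℂ) * (d.choose k : ℂ) * (-lam⁻¹) ^ r * h2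
  · intro i hi
    rw [Nat.choose_eq_zero_of_lt (show i < r by simpa using hi)]
    simp

/-- The probability generating function in closed form. -/
lemma hasSum_genPoissonProb_mul_pow {lam : ℝ} (hlam : lam ≠ 0) (m : ℕ) (z : ℂ) :
    HasSum (fun j : ℕ => (genPoissonProb lam m j : ℂ) * z ^ j)
      (Complex.exp (lam * (z - 1)) * ∑ r ∈ Finset.range (m + 1),
        (m.choose r : ℂ) / ((m - r).factorial : ℂ) * z ^ r * (lam * (z - 1) ^ 2) ^ (m - r)) := by
  have hlam' : (lam : ℂ) ≠ 0 := by exact_mod_cast hlam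
  set w : ℂ := lam * z with hw
  -- After squaring and linearizing, each weight is a finite combination of terms whose series in j
  -- are known.
  have h1 : HasSum (fun j : ℕ => ∑ i ∈ Finset.range (m + 1), ∑ l ∈ Finset.range (m + 1),
      ∑ r ∈ Finset.range (m + 1), ((m.choose i : ℂ) * (-(lam : ℂ)⁻¹) ^ i * ((m.choose l : ℂ) *
        (-(lam : ℂ)⁻¹) ^ l) * ((i.choose r : ℂ) * (l.choose r : ℂ) * (r.factorial : ℂ))) *
        ((j.descFactorial (i + l - r) : ℂ) * (w ^ j / (j.factorial : ℂ))))
      (∑ i ∈ Finset.range (m + 1), ∑ l ∈ Finset.range (m + 1),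
      ∑ r ∈ Finset.range (m + 1), ((m.choose i : ℂ) * (-(lam : ℂ)⁻¹) ^ i * ((m.choose l : ℂ) *
        (-(lam : ℂ)⁻¹) ^ l) * ((i.choose r : ℂ) * (l.choose r : ℂ) * (r.factorial : ℂ))) *
        (w ^ (i + l - r) * Complex.exp w)) :=
    hasSum_sum fun i _ => hasSum_sum fun l _ => hasSum_sum fun r _ =>
      (hasSum_descFactorial_mul_pow_div_factorial _ w).mul_left _
  have h2 := h1.mul_left (Complex.exp (-lam) * (lam : ℂ) ^ m / (m.factorial : ℂ))
  have hval : (Complex.exp (-lam) * (lam : ℂ) ^ m / (m.factorial : ℂ)) *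
      (∑ i ∈ Finset.range (m + 1), ∑ l ∈ Finset.range (m + 1),
      ∑ r ∈ Finset.range (m + 1), ((m.choose i : ℂ) * (-(lam : ℂ)⁻¹) ^ i * ((m.choose l : ℂ) *
        (-(lam : ℂ)⁻¹) ^ l) * ((i.choose r : ℂ) * (l.choose r : ℂ) * (r.factorial : ℂ))) *
        (w ^ (i + l - r) * Complex.exp w)) =
      Complex.exp (lam * (z - 1)) * ∑ r ∈ Finset.range (m + 1),
        (m.choose r : ℂ) / ((m - r).factorial : ℂ) * z ^ r * (lam * (z - 1) ^ 2) ^ (m - r) := by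
    have hsw : (∑ i ∈ Finset.range (m + 1), ∑ l ∈ Finset.range (m + 1),
        ∑ r ∈ Finset.range (m + 1), ((m.choose i : ℂ) * (-(lam : ℂ)⁻¹) ^ i * ((m.choose l : ℂ) *
        (-(lam : ℂ)⁻¹) ^ l) * ((i.choose r : ℂ) * (l.choose r : ℂ) * (r.factorial : ℂ))) *
        (w ^ (i + l - r) * Complex.exp w)) =
        ∑ r ∈ Finset.range (m + 1), Complex.exp w * ((r.factorial : ℂ) * w ^ r *
          (∑ i ∈ Finset.range (m + 1), (m.choose i : ℂ) * (i.choose r : ℂ) * (-(lam : ℂ)⁻¹) ^ i *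
            w ^ (i - r)) ^ 2) := by
      -- With r outermost, the sums over i and l decouple into a square.
      rw [Finset.sum_congr rfl fun i _ => Finset.sum_comm, Finset.sum_comm]
      refine Finset.sum_congr rfl fun r _ => ?_
      rw [sq, Finset.sum_mul_sum, Finset.mul_sum, Finset.mul_sum]
      refine Finset.sum_congr rfl fun i _ => ?_
      rw [Finset.mul_sum, Finset.mul_sum]
      refine Finset.sum_congr rfl fun l _ => ?_
      rcases lt_or_ge i r with hi | hi
      · rw [Nat.choose_eq_zero_of_lt hi]
        simp
      rcases lt_or_ge l r with hl | hl
      · rw [Nat.choose_eq_zero_of_lt hl]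
        simp
      obtain ⟨i', rfl⟩ := Nat.exists_eq_add_of_le hi
      obtain ⟨l', rfl⟩ := Nat.exists_eq_add_of_le hl
      rw [Nat.add_sub_cancel_left, Nat.add_sub_cancel_left,
        show r + i' + (r + l') - r = r + i' + l' by omega, pow_add w, pow_add w]
      ring
    rw [hsw, Finset.mul_sum, Finset.mul_sum]
    refine Finset.sum_congr rfl fun r hr => ?_
    have hr : r ≤ m := by simpa [Nat.lt_succ_iff] using hr
    rw [hw, sum_choose_mul_choose_mul_pow hlam' z hr,
      show (lam : ℂ) * (z - 1) = -lam + lam * z by ring, Complex.exp_add]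
    have hc : (m.choose r : ℂ) * r.factorial * (m - r).factorial = m.factorial := by
      exact_mod_cast Nat.choose_mul_factorial_mul_factorial hr
    have hf1 : (m.factorial : ℂ) ≠ 0 := by exact_mod_cast Nat.factorial_ne_zero m
    have hf2 : ((m - r).factorial : ℂ) ≠ 0 := by exact_mod_cast Nat.factorial_ne_zero _
    have hm : (lam : ℂ) ^ m = (lam : ℂ) ^ r * (lam : ℂ) ^ (m - r) := by
      rw [← pow_add, Nat.add_sub_cancel' hr]
    have hl : (lam : ℂ) ^ r * lam ^ r * ((-(lam : ℂ)⁻¹) ^ r) ^ 2 = 1 := by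
      rw [← pow_mul, mul_comm r 2, pow_mul, neg_sq, ← pow_mul, mul_comm 2 r, pow_mul, ← mul_pow,
        ← pow_mul, mul_comm r 2, pow_mul, ← mul_pow]
      field_simp
      simp
    have hz : ((1 - z) ^ (m - r)) ^ 2 = ((z - 1) ^ 2) ^ (m - r) := by
      rw [← pow_mul, mul_comm, pow_mul]
      congr 1
      ring
    have hcc : (m.choose r : ℂ) / ((m - r).factorial : ℂ) =
        (r.factorial : ℂ) * (m.choose r : ℂ) ^ 2 / (m.factorial : ℂ) := by
      rw [div_eq_div_iff hf2 hf1, ← hc]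
      ring
    rw [hcc, mul_pow (lam : ℂ) _ (m - r), ← hz, hm]
    linear_combination (Complex.exp (-lam) * Complex.exp (lam * z) * (lam : ℂ) ^ (m - r) *
      (r.factorial : ℂ) / (m.factorial : ℂ) * (m.choose r : ℂ) ^ 2 * z ^ r *
      ((1 - z) ^ (m - r)) ^ 2) * hl
  rw [hval] at h2
  refine h2.congr_fun fun j => ?_
  rw [genPoissonProb_eq hlam]
  have hterm : ∀ i ∈ Finset.range (m + 1), ∀ l ∈ Finset.range (m + 1),
      ∑ r ∈ Finset.range (m + 1), ((m.choose i : ℂ) * (-(lam : ℂ)⁻¹) ^ i * ((m.choose l : ℂ) *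
        (-(lam : ℂ)⁻¹) ^ l) * ((i.choose r : ℂ) * (l.choose r : ℂ) * (r.factorial : ℂ))) *
        ((j.descFactorial (i + l - r) : ℂ) * (w ^ j / (j.factorial : ℂ))) =
      ((m.choose i : ℂ) * (j.choose i : ℂ) * (i.factorial : ℂ) * (-(lam : ℂ)⁻¹) ^ i) *
      ((m.choose l : ℂ) * (j.choose l : ℂ) * (l.factorial : ℂ) * (-(lam : ℂ)⁻¹) ^ l) *
        (w ^ j / (j.factorial : ℂ)) := by
    intro i _ l hl
    have h := descFactorial_mul_descFactorial_eq_sum (i := i)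
      (show l ≤ m by simpa [Nat.lt_succ_iff] using hl) j
    rw [Nat.descFactorial_eq_factorial_mul_choose, Nat.descFactorial_eq_factorial_mul_choose] at h
    have h' := congrArg (Nat.cast (R := ℂ)) h
    push_cast at h'
    calc _ = ((m.choose i : ℂ) * (-(lam : ℂ)⁻¹) ^ i * ((m.choose l : ℂ) *
        (-(lam : ℂ)⁻¹) ^ l)) * (w ^ j / (j.factorial : ℂ)) * ∑ r ∈ Finset.range (m + 1),
        (i.choose r : ℂ) * l.choose r * r.factorial * j.descFactorial (i + l - r) := by
          rw [Finset.mul_sum]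
          exact Finset.sum_congr rfl fun r _ => by ring
      _ = _ := by
          rw [← h']
          ring
  rw [Finset.sum_congr rfl fun i hi => Finset.sum_congr rfl fun l hl => hterm i hi l hl]
  simp only [← Finset.sum_mul, ← Finset.mul_sum, charlier]
  push_cast
  rw [hw]
  ring

lemma hasSum_genPoissonProb_mul_pow_real {lam : ℝ} (hlam : lam ≠ 0) (m : ℕ) (z : ℝ) :
    HasSum (fun j : ℕ => genPoissonProb lam m j * z ^ j) (genPoissonPGF lam m z) := by
  have h := (hasSum_genPoissonProb_mul_pow hlam m z).summable
  refine Summable.hasSum ?_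
  rw [← Complex.summable_ofReal]
  simpa using h

lemma hasSum_genPoissonProb {lam : ℝ} (hlam : lam ≠ 0) (m : ℕ) :
    HasSum (genPoissonProb lam m) 1 := by
  have h := hasSum_genPoissonProb_mul_pow hlam m 1
  rw [Finset.sum_eq_single m] at h
  · rw [← Complex.hasSum_ofReal]
    simpa using h
  · intro r hr hrm
    have : m - r ≠ 0 := by
      have : r < m + 1 := by simpa using hr
      omega
    simp [this]
  · simp

/-! ### The law and its characteristic function -/

lemma isProbabilityMeasure_genPoissonLaw {lam : ℝ} (hlam : 0 < lam) (m : ℕ) :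
    IsProbabilityMeasure (genPoissonLaw lam m) :=
  HasSum.isProbabilityMeasure_sum_dirac (genPoissonProb_nonneg hlam m)
    (hasSum_genPoissonProb hlam.ne' m)

lemma charFun_genPoissonLaw {lam : ℝ} (hlam : 0 < lam) (m : ℕ) (u : ℝ) :
    charFun (genPoissonLaw lam m) u =
      Complex.exp (lam * (Complex.exp (Complex.I * u) - 1)) *
        Complex.exp (Complex.I * m * u) *
          (((laguerre 0 m).eval (2 * lam * (1 - Real.cos u)) : ℝ) : ℂ) := by
  set z : ℂ := Complex.exp (Complex.I * u) with hz
  have hn : ∀ j : ℕ, ‖Complex.exp (u * (j : ℝ) * Complex.I)‖ = 1 := by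
    intro j
    rw [← Complex.ofReal_mul, Complex.norm_exp_ofReal_mul_I]
  have h1 : HasSum (fun j : ℕ => (genPoissonProb lam m j : ℂ) * z ^ j)
      (charFun (genPoissonLaw lam m) u) := by
    rw [charFun_apply_real]
    have h := hasSum_integral_sum_dirac (f := fun x : ℝ => Complex.exp (u * x * Complex.I))
      (x := fun j : ℕ => (j : ℝ)) (c := fun j => ENNReal.ofReal (genPoissonProb lam m j))
      (fun _ => ENNReal.ofReal_ne_top) (by
        simp only [hn, mul_one, ENNReal.toReal_ofReal (genPoissonProb_nonneg hlam m _)]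
        exact (hasSum_genPoissonProb hlam.ne' m).summable)
    refine h.congr_fun fun j => ?_
    rw [ENNReal.toReal_ofReal (genPoissonProb_nonneg hlam m _), hz, ← Complex.exp_nat_mul,
      Complex.real_smul]
    congr 2
    push_cast
    ring
  rw [h1.unique (hasSum_genPoissonProb_mul_pow hlam.ne' m z), mul_assoc]
  congr 1
  have hz0 : z ≠ 0 := Complex.exp_ne_zero _
  have hzm : Complex.exp (Complex.I * m * u) = z ^ m := by
    rw [hz, ← Complex.exp_nat_mul]
    congr 1
    ring
  -- This substitution, with z^m factored out and the summation reversed, turns the closed form into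
  -- `L_m`.
  have hcos : (2 * (lam : ℂ) * (1 - Complex.cos u)) = -(lam * (z - 1) ^ 2 / z) := by
    have h2 : 2 * Complex.cos u = z + z⁻¹ := by
      rw [Complex.two_cos, hz, ← Complex.exp_neg]
      congr 2 <;> ring
    have h3 : (2 * (lam : ℂ) * (1 - Complex.cos u)) = lam * (2 - (z + z⁻¹)) := by
      rw [← h2]
      ring
    rw [h3]
    field_simp
    ring
  rw [hzm, laguerre_eval]
  push_cast
  rw [hcos, Finset.mul_sum, ← Finset.sum_flip]
  refine Finset.sum_congr rfl fun i hi => ?_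
  have hi : i ≤ m := by simpa [Nat.lt_succ_iff] using hi
  rw [Nat.sub_sub_self hi, add_zero, Nat.choose_symm hi, neg_pow (_ / _), div_pow]
  have hs : ((-1 : ℂ) ^ i) * (-1) ^ i = 1 := by rw [← mul_pow]; simp
  have hm : z ^ m = z ^ (m - i) * z ^ i := by rw [← pow_add, Nat.sub_add_cancel hi]
  have hzi : z ^ i ≠ 0 := pow_ne_zero _ hz0
  rw [hm]
  field_simp
  linear_combination (-(m.choose i : ℂ) / (i.factorial : ℂ) * (lam * (z - 1) ^ 2) ^ i) * hs

/-! ### Zeros of characteristic functions of infinitely divisible laws -/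

/-- The characteristic function `ψ` of a law satisfies `1 - |ψ(2u)|² ≤ 4 (1 - |ψ(u)|²)`. -/
lemma one_sub_normSq_charFun_two_mul_le (ν : Measure ℝ) [IsProbabilityMeasure ν] (u : ℝ) :
    1 - ‖charFun ν (2 * u)‖ ^ 2 ≤ 4 * (1 - ‖charFun ν u‖ ^ 2) := by
  have hmap : IsProbabilityMeasure (ν.map (fun x => -1 * x)) :=
    Measure.isProbabilityMeasure_map (by fun_prop)
  -- Symmetrization makes |ψ|² itself a characteristic function, an integral of cosines; the bound
  -- is then pointwise, since 4(1 - c) - (2 - 2c²) = 2(1 - c)².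
  set ρ : Measure ℝ := ν ∗ ν.map (fun x => -1 * x) with hρ
  have hcf : ∀ t : ℝ, ∫ x, Real.cos (t * x) ∂ρ = ‖charFun ν t‖ ^ 2 := by
    intro t
    have h1 : charFun ρ t = ((‖charFun ν t‖ ^ 2 : ℝ) : ℂ) := by
      rw [hρ, charFun_conv, charFun_map_mul, neg_one_mul, charFun_neg, Complex.mul_conj,
        Complex.normSq_eq_norm_sq]
    have h2 := congrArg Complex.re h1
    rw [Complex.ofReal_re, charFun_apply_real] at h2
    rw [← h2]
    have hint : Integrable (fun x : ℝ => Complex.exp (t * x * Complex.I)) ρ := by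
      refine Integrable.of_bound (by fun_prop) 1 (Filter.Eventually.of_forall fun x => ?_)
      rw [← Complex.ofReal_mul, Complex.norm_exp_ofReal_mul_I]
    have h3 := integral_re hint
    simp only [RCLike.re_eq_complex_re] at h3
    rw [← h3]
    refine integral_congr_ae (Filter.Eventually.of_forall fun x => ?_)
    simp only
    rw [← Complex.ofReal_mul, Complex.exp_ofReal_mul_I_re]
  have hI : ∀ t : ℝ, Integrable (fun x : ℝ => Real.cos (t * x)) ρ := fun t =>
    Integrable.of_bound (by fun_prop) 1
      (Filter.Eventually.of_forall fun x => by simpa using Real.abs_cos_le_one _)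
  have h1 : ∀ t : ℝ, ∫ x, (1 - Real.cos (t * x)) ∂ρ = 1 - ‖charFun ν t‖ ^ 2 := by
    intro t
    rw [integral_sub (integrable_const _) (hI t), hcf]
    simp
  rw [← h1, ← h1, ← integral_const_mul]
  refine integral_mono ((integrable_const _).sub (hI _))
    (((integrable_const _).sub (hI _)).const_mul _) fun x => ?_
  simp only
  rw [mul_assoc, Real.cos_two_mul]
  nlinarith [sq_nonneg (Real.cos (u * x) - 1)]

/-- Every n-th root ψ also vanishes at 2u, so |ψ(u)|² ≤ 3/4 and the squared modulus at u is at most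
(3/4)^n for every n ≥ 1. -/
lemma charFun_eq_zero_of_isInfinitelyDivisible {μ : Measure ℝ} (hμ : IsInfinitelyDivisible μ)
    {u : ℝ} (hu : charFun μ (2 * u) = 0) : charFun μ u = 0 := by
  by_contra hne
  have hroot : ∀ n : ℕ, 1 ≤ n → ∃ ψ : ℝ, 0 ≤ ψ ∧ ψ ^ n = ‖charFun μ u‖ ∧ ψ ^ 2 ≤ 3 / 4 := by
    intro n hn
    obtain ⟨ν, hν, hsum⟩ := hμ n hn
    have h : ∀ t, charFun μ t = charFun ν t ^ n := by
      intro t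
      rw [← hsum, ProbabilityTheory.charFun_map_sum_pi_eq_prod]
      simp
    refine ⟨‖charFun ν u‖, norm_nonneg _, by rw [h, norm_pow], ?_⟩
    have h0 : charFun ν (2 * u) = 0 := by
      rw [h] at hu
      exact pow_eq_zero_iff (by omega) |>.1 hu
    have := one_sub_normSq_charFun_two_mul_le ν u
    rw [h0] at this
    norm_num at this
    linarith
  have hle : ∀ n : ℕ, 1 ≤ n → ‖charFun μ u‖ ^ 2 ≤ (3 / 4 : ℝ) ^ n := by
    intro n hn
    obtain ⟨ψ, h0, h1, h2⟩ := hroot n hn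
    rw [← h1, ← pow_mul, mul_comm, pow_mul]
    exact pow_le_pow_left₀ (sq_nonneg _) h2 n
  have hpos : 0 < ‖charFun μ u‖ ^ 2 := by positivity
  obtain ⟨n, hn⟩ := exists_pow_lt_of_lt_one hpos (show (3 / 4 : ℝ) < 1 by norm_num)
  have h1 := hle (n + 1) (by omega)
  have h2 : (3 / 4 : ℝ) ^ (n + 1) ≤ (3 / 4) ^ n :=
    pow_le_pow_of_le_one (by norm_num) (by norm_num) (by omega)
  linarith

/-- The characteristic function of an infinitely divisible law has no zeros. -/
lemma IsInfinitelyDivisible.charFun_ne_zero {μ : Measure ℝ} [IsProbabilityMeasure μ]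
    (hμ : IsInfinitelyDivisible μ) (u : ℝ) : charFun μ u ≠ 0 := by
  intro hu
  -- Halving pushes the zeros to the origin, against continuity and the value 1 there.
  have h : ∀ n : ℕ, charFun μ (u * (1 / 2) ^ n) = 0 := by
    intro n
    induction n with
    | zero => simpa using hu
    | succ n ih =>
      refine charFun_eq_zero_of_isInfinitelyDivisible hμ ?_
      rw [← ih]
      congr 1
      ring
  have hlim : Filter.Tendsto (fun n : ℕ => charFun μ (u * (1 / 2) ^ n)) Filter.atTop
      (nhds (charFun μ (u * 0))) :=
    (continuous_charFun.tendsto _).comp ((tendsto_pow_atTop_nhds_zero_of_lt_one (by norm_num)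
      (by norm_num)).const_mul u)
  simp only [h] at hlim
  have := tendsto_nhds_unique tendsto_const_nhds hlim
  simp at this

/-! ### Infinitely divisible laws on the natural numbers -/

section Lattice

variable {μ ν : Measure ℝ} [IsProbabilityMeasure ν] {n : ℕ}

lemma measurable_sum_fin (n : ℕ) : Measurable fun y : Fin n → ℝ => ∑ k, y k := by fun_prop

/-- If all n summands are negative, so is their sum. -/
lemma measure_Iio_zero_eq_zero_of_sum (hn : 1 ≤ n)
    (hμ : (Measure.pi fun _ : Fin n => ν).map (fun y => ∑ k, y k) = μ)
    (h0 : μ (Set.Iio 0) = 0) : ν (Set.Iio 0) = 0 := by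
  rw [← hμ, Measure.map_apply (measurable_sum_fin n) measurableSet_Iio] at h0
  have h := measure_mono_null (s := Set.univ.pi fun _ : Fin n => Set.Iio (0 : ℝ)) ?_ h0
  · rw [Measure.pi_pi] at h
    simpa [Finset.prod_const, show n ≠ 0 by omega] using h
  · intro y hy
    have : Nonempty (Fin n) := ⟨⟨0, hn⟩⟩
    exact Finset.sum_neg (fun k _ => Set.mem_Iio.1 (hy k trivial)) Finset.univ_nonempty

lemma ae_pi_forall {p : ℝ → Prop} (hp : ∀ᵐ t ∂ν, p t) :
    ∀ᵐ y ∂(Measure.pi fun _ : Fin n => ν), ∀ k, p (y k) :=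
  ae_all_iff.2 fun _ => Measure.tendsto_eval_ae_ae.eventually hp

lemma measure_singleton_zero_of_sum (hν : ν (Set.Iio 0) = 0)
    (hμ : (Measure.pi fun _ : Fin n => ν).map (fun y => ∑ k, y k) = μ) :
    μ {0} = ν {0} ^ n := by
  rw [← hμ, Measure.map_apply (measurable_sum_fin n) (measurableSet_singleton _)]
  have h : ν {0} ^ n = (Measure.pi fun _ : Fin n => ν) (Set.univ.pi fun _ => {0}) := by
    rw [Measure.pi_pi]
    simp
  rw [h]
  refine measure_congr ?_
  have hae : ∀ᵐ t ∂ν, 0 ≤ t := by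
    rw [ae_iff]
    simpa [Set.Iio] using hν
  filter_upwards [ae_pi_forall (n := n) hae] with y hy
  refine propext ?_
  change ∑ k, y k = 0 ↔ ∀ k ∈ Set.univ, y k = 0
  rw [Finset.sum_eq_zero_iff_of_nonneg fun k _ => hy k]
  simp

/-- The mass of the box with sides `A` at the indices in `s` and `{0}` elsewhere. -/
lemma measure_pi_ite (s : Finset (Fin n)) (A : Set ℝ) :
    (Measure.pi fun _ : Fin n => ν) (Set.univ.pi fun k => if k ∈ s then A else {0}) =
      ν A ^ s.card * ν {0} ^ (n - s.card) := by
  classical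
  rw [Measure.pi_pi]
  have : ∀ k, ν (if k ∈ s then A else {0}) = if k ∈ s then ν A else ν {0} := by
    intro k
    split_ifs <;> rfl
  simp only [this]
  rw [Finset.prod_ite, Finset.prod_const, Finset.prod_const, Finset.filter_mem_eq_inter,
    Finset.univ_inter, Finset.filter_not, Finset.filter_mem_eq_inter, Finset.univ_inter,
    ← Finset.compl_eq_univ_sdiff, Finset.card_compl, Fintype.card_fin]

/-- One summand in A and the others 0 put the sum in A. With A the complement of ℕ, this places the
n-th root on ℕ. -/
lemma measure_eq_zero_of_sum (hn : 1 ≤ n) (h0 : ν {0} ≠ 0)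
    (hμ : (Measure.pi fun _ : Fin n => ν).map (fun y => ∑ k, y k) = μ) {A : Set ℝ}
    (hA : MeasurableSet A) (hμA : μ A = 0) : ν A = 0 := by
  rw [← hμ, Measure.map_apply (measurable_sum_fin n) hA] at hμA
  have h := measure_mono_null (s := Set.univ.pi fun k : Fin n =>
    if k ∈ ({⟨0, hn⟩} : Finset (Fin n)) then A else {0}) ?_ hμA
  · rw [measure_pi_ite] at h
    simpa [h0] using h
  · intro y hy
    have h1 : ∀ k ≠ (⟨0, hn⟩ : Fin n), y k = 0 := by
      intro k hk
      have := hy k trivial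
      simpa [hk] using this
    have h2 := hy ⟨0, hn⟩ trivial
    change ∑ k, y k ∈ A
    rw [Finset.sum_eq_single ⟨0, hn⟩ (fun k _ hk => h1 k hk) (by simp)]
    simpa using h2

/-- Natural numbers with sum 1 consist of a single 1 and zeros; the bound is the union bound over
its position. -/
lemma measure_singleton_one_le_of_sum (hν : ∀ᵐ t : ℝ ∂ν, ∃ j : ℕ, t = j)
    (hμ : (Measure.pi fun _ : Fin n => ν).map (fun y => ∑ k, y k) = μ) :
    μ {1} ≤ n * (ν {1} * ν {0} ^ (n - 1)) := by
  classical
  rw [← hμ, Measure.map_apply (measurable_sum_fin n) (measurableSet_singleton _)]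
  calc _ ≤ (Measure.pi fun _ : Fin n => ν) (⋃ i : Fin n,
        Set.univ.pi fun k => if k ∈ ({i} : Finset (Fin n)) then {1} else {0}) := by
        refine measure_mono_ae ?_
        filter_upwards [ae_pi_forall (n := n) hν] with y hy
        intro h
        choose j hj using hy
        have h : ∑ k, y k = 1 := h
        have h' : ∑ k, j k = 1 := by
          simp only [hj] at h
          exact_mod_cast h
        obtain ⟨i, -, hi⟩ := Finset.exists_ne_zero_of_sum_ne_zero (by rw [h']; exact one_ne_zero)
        have hsplit := Finset.add_sum_erase Finset.univ j (Finset.mem_univ i)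
        have hi1 : j i = 1 := by omega
        have hrest : ∑ k ∈ Finset.univ.erase i, j k = 0 := by omega
        refine Set.mem_iUnion.2 ⟨i, fun k _ => ?_⟩
        by_cases hk : k = i
        · simp [hk, hj, hi1]
        · have := Finset.sum_eq_zero_iff.1 hrest k (by simp [hk])
          simp [hk, hj, this]
    _ ≤ ∑ i : Fin n, (Measure.pi fun _ : Fin n => ν)
        (Set.univ.pi fun k => if k ∈ ({i} : Finset (Fin n)) then {1} else {0}) :=
        measure_iUnion_fintype_le _ _
    _ = _ := by
        simp only [measure_pi_ite]
        simp

/-- Only the outcomes with exactly two ones and otherwise zeros are counted; these boxes are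
disjoint. -/
lemma le_measure_singleton_two_of_sum
    (hμ : (Measure.pi fun _ : Fin n => ν).map (fun y => ∑ k, y k) = μ) :
    n.choose 2 * (ν {1} ^ 2 * ν {0} ^ (n - 2)) ≤ μ {2} := by
  classical
  rw [← hμ, Measure.map_apply (measurable_sum_fin n) (measurableSet_singleton _)]
  set B : Finset (Fin n) → Set (Fin n → ℝ) := fun s =>
    Set.univ.pi fun k => if k ∈ s then {1} else {0} with hB
  have hmem : ∀ s y, y ∈ B s ↔ ∀ k, y k = if k ∈ s then 1 else 0 := by
    intro s y
    simp only [hB, Set.mem_univ_pi]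
    refine forall_congr' fun k => ?_
    split_ifs <;> simp
  calc _ = ∑ s ∈ Finset.powersetCard 2 Finset.univ, (Measure.pi fun _ : Fin n => ν) (B s) := by
        rw [Finset.sum_congr rfl (g := fun _ => ν {1} ^ 2 * ν {0} ^ (n - 2)), Finset.sum_const,
          Finset.card_powersetCard, Finset.card_univ, Fintype.card_fin, nsmul_eq_mul]
        intro s hs
        rw [hB, measure_pi_ite, (Finset.mem_powersetCard.1 hs).2]
    _ = (Measure.pi fun _ : Fin n => ν) (⋃ s ∈ Finset.powersetCard 2 Finset.univ, B s) := by
        rw [measure_biUnion_finset]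
        · intro s _ t _ hst
          refine Set.disjoint_left.2 fun y hs ht => hst ?_
          rw [hmem] at hs ht
          ext k
          have := (hs k).symm.trans (ht k)
          split_ifs at this <;> simp_all
        · intro s _
          refine MeasurableSet.univ_pi fun k => ?_
          split_ifs <;> exact measurableSet_singleton _
    _ ≤ _ := by
        refine measure_mono (Set.iUnion₂_subset fun s hs y hy => ?_)
        rw [hmem] at hy
        change ∑ k, y k = 2
        simp only [hy]
        rw [Finset.sum_ite_mem, Finset.univ_inter, Finset.sum_const,
          (Finset.mem_powersetCard.1 hs).2]
        norm_num

end Lattice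

/-- For an infinitely divisible law on `ℕ` that charges `0`, the second coefficient of the
logarithmic derivative of the probability generating function is nonnegative. -/
lemma IsInfinitelyDivisible.sq_measureReal_one_le {μ : Measure ℝ} [IsProbabilityMeasure μ]
    (hμ : IsInfinitelyDivisible μ) (hnat : μ (Set.range ((↑) : ℕ → ℝ))ᶜ = 0) (h0 : μ {0} ≠ 0) :
    μ.real {1} ^ 2 ≤ 2 * μ.real {0} * μ.real {2} := by
  -- With a = ν{0} and b = ν{1}: p_0 = a^n, p_1 ≤ n b a^(n-1), p_2 ≥ C(n,2) b² a^(n-2). Eliminating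
  -- a and b loses only the factor (n - 1)/n, which tends to 1.
  have key : ∀ n : ℕ, 1 ≤ n →
      ((n : ℝ) - 1) * μ.real {1} ^ 2 ≤ n * (2 * μ.real {0} * μ.real {2}) := by
    intro n hn
    rcases hn.eq_or_lt with rfl | hn2
    · simp only [Nat.cast_one, sub_self, zero_mul, one_mul]
      positivity
    obtain ⟨ν, hν, hsum⟩ := hμ n hn
    have hneg : μ (Set.Iio 0) = 0 := by
      refine measure_mono_null ?_ hnat
      rintro t ht ⟨j, rfl⟩
      exact absurd ht (by simp)
    have hνneg := measure_Iio_zero_eq_zero_of_sum hn hsum hneg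
    have hz := measure_singleton_zero_of_sum hνneg hsum
    have hν0 : ν {0} ≠ 0 := by
      intro h
      rw [hz, h, zero_pow (by omega)] at h0
      exact h0 rfl
    have hνnat := measure_eq_zero_of_sum hn hν0 hsum
      (Set.countable_range _).measurableSet.compl hnat
    have hae : ∀ᵐ t : ℝ ∂ν, ∃ j : ℕ, t = j := by
      rw [ae_iff]
      refine measure_mono_null ?_ hνnat
      rintro t ht ⟨j, rfl⟩
      exact ht ⟨j, rfl⟩
    have h1 := measure_singleton_one_le_of_sum hae hsum
    have h2 := le_measure_singleton_two_of_sum hsum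
    have r0 : μ.real {0} = ν.real {0} ^ n := by
      simp [Measure.real, hz]
    have r1 : μ.real {1} ≤ n * (ν.real {1} * ν.real {0} ^ (n - 1)) := by
      have := ENNReal.toReal_mono (by finiteness) h1
      simpa [Measure.real] using this
    have r2 : n.choose 2 * (ν.real {1} ^ 2 * ν.real {0} ^ (n - 2)) ≤ μ.real {2} := by
      have := ENNReal.toReal_mono (by finiteness) h2
      simpa [Measure.real] using this
    obtain ⟨d, rfl⟩ : ∃ d, n = d + 2 := ⟨n - 2, by omega⟩
    rw [Nat.cast_choose_two] at r2
    rw [Nat.add_sub_cancel] at r2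
    rw [show d + 2 - 1 = d + 1 by omega] at r1
    push_cast at *
    set a := ν.real {0}
    set b := ν.real {1}
    have ha : 0 ≤ a := measureReal_nonneg
    have hb : 0 ≤ b := measureReal_nonneg
    have e1 : μ.real {1} ^ 2 ≤ (((d : ℝ) + 2) * (b * a ^ (d + 1))) ^ 2 :=
      pow_le_pow_left₀ measureReal_nonneg r1 2
    have e2 := mul_le_mul_of_nonneg_left r2 (show 0 ≤ a ^ (d + 2) by positivity)
    rw [r0]
    calc ((d : ℝ) + 2 - 1) * μ.real {1} ^ 2
        ≤ ((d : ℝ) + 2 - 1) * (((d : ℝ) + 2) * (b * a ^ (d + 1))) ^ 2 :=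
          mul_le_mul_of_nonneg_left e1 (by linarith [Nat.cast_nonneg (α := ℝ) d])
      _ = ((d : ℝ) + 2) * (2 * (a ^ (d + 2) *
          (((d : ℝ) + 2) * ((d : ℝ) + 2 - 1) / 2 * (b ^ 2 * a ^ d)))) := by ring
      _ ≤ ((d : ℝ) + 2) * (2 * (a ^ (d + 2) * μ.real {2})) := by gcongr
      _ = _ := by ring
  by_contra! hlt
  obtain ⟨n, hn⟩ := exists_nat_gt (μ.real {1} ^ 2 / (μ.real {1} ^ 2 - 2 * μ.real {0} * μ.real {2}))
  rw [div_lt_iff₀ (by linarith)] at hn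
  have h1 := key (n + 1) (by omega)
  push_cast at h1
  nlinarith [measureReal_nonneg (μ := μ) (s := {0}), measureReal_nonneg (μ := μ) (s := {2}),
    mul_nonneg (measureReal_nonneg (μ := μ) (s := {0})) (measureReal_nonneg (μ := μ) (s := {2}))]

/-! ### The first three weights and the logarithmic derivative -/

lemma measureReal_genPoissonLaw_singleton {lam : ℝ} (hlam : 0 < lam) (m j : ℕ) :
    (genPoissonLaw lam m).real {(j : ℝ)} = genPoissonProb lam m j := by
  rw [Measure.real, genPoissonLaw, Measure.sum_apply _ (measurableSet_singleton _),
    tsum_eq_single j]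
  · simp [ENNReal.toReal_ofReal (genPoissonProb_nonneg hlam m j)]
  · intro i hi
    simp [hi]

lemma genPoissonLaw_compl_range_natCast (lam : ℝ) (m : ℕ) :
    genPoissonLaw lam m (Set.range ((↑) : ℕ → ℝ))ᶜ = 0 := by
  rw [genPoissonLaw, Measure.sum_apply _ (Set.countable_range _).measurableSet.compl]
  simp

lemma genPoissonProb_zero_pos {lam : ℝ} (hlam : 0 < lam) (m : ℕ) : 0 < genPoissonProb lam m 0 := by
  rw [genPoissonProb_eq hlam.ne', charlier_comm, charlier]
  simp
  positivity

lemma two_mul_genPoissonProb_lt_sq {lam : ℝ} (hlam : 0 < lam) {m : ℕ} (hm : 1 ≤ m)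
    (h : lam < m / 4) :
    2 * genPoissonProb lam m 0 * genPoissonProb lam m 2 < genPoissonProb lam m 1 ^ 2 := by
  have hm' : (1 : ℝ) ≤ m := by exact_mod_cast hm
  simp only [genPoissonProb_eq hlam.ne', charlier_comm _ m]
  simp only [charlier, Finset.sum_range_succ, Finset.sum_range_zero]
  simp only [Nat.choose_self, Nat.choose_zero_right, Nat.choose_one_right, Nat.factorial,
    Nat.cast_choose_two]
  have hpos : 0 < Real.exp (-lam) ^ 2 * lam ^ (2 * m) * m / ((m.factorial : ℝ) ^ 2 * lam ^ 2) := by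
    positivity
  -- From λ < m/4, 2(λ - m)² exceeds 9m²/8 ≥ m. The difference of the two sides of the goal is the
  -- factor in `hpos` times 2(λ - m)² - m.
  have h2 : (m : ℝ) < 2 * (lam - m) ^ 2 := by nlinarith
  have := mul_pos hpos (sub_pos.2 h2)
  have hf : (m.factorial : ℝ) ≠ 0 := by exact_mod_cast Nat.factorial_ne_zero m
  have hl := hlam.ne'
  rw [← sub_pos]
  refine this.trans_eq ?_
  push_cast
  field_simp
  ring

lemma hasFPowerSeriesOnBall_genPoissonPGF {lam : ℝ} (hlam : lam ≠ 0) (m : ℕ) :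
    HasFPowerSeriesOnBall (genPoissonPGF lam m)
      (FormalMultilinearSeries.ofScalars ℝ (genPoissonProb lam m)) 0 ⊤ := by
  refine ⟨?_, ENNReal.zero_lt_top, fun {y} _ => ?_⟩
  · rw [top_le_iff, FormalMultilinearSeries.radius_eq_top_of_summable_norm]
    intro r
    have h := (hasSum_genPoissonProb_mul_pow_real hlam m r).summable.norm
    simpa [FormalMultilinearSeries.ofScalars_norm] using h
  · rw [zero_add]
    refine (hasSum_genPoissonProb_mul_pow_real hlam m y).congr_fun fun j => ?_
    simp [mul_comm]

lemma iteratedDeriv_genPoissonPGF_zero {lam : ℝ} (hlam : lam ≠ 0) (m j : ℕ) :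
    iteratedDeriv j (genPoissonPGF lam m) 0 = j.factorial * genPoissonProb lam m j := by
  have h := (hasFPowerSeriesOnBall_genPoissonPGF hlam m).factorial_smul 1 j
  rw [iteratedDeriv_eq_iteratedFDeriv, ← h]
  simp

lemma deriv_logDeriv_genPoissonPGF_zero {lam : ℝ} (hlam : 0 < lam) (m : ℕ) :
    deriv (logDeriv (genPoissonPGF lam m)) 0 =
      (2 * genPoissonProb lam m 0 * genPoissonProb lam m 2 - genPoissonProb lam m 1 ^ 2) /
        genPoissonProb lam m 0 ^ 2 := by
  have ha := (hasFPowerSeriesOnBall_genPoissonPGF hlam.ne' m).analyticAt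
  have h0 : genPoissonPGF lam m 0 = genPoissonProb lam m 0 := by
    simpa using iteratedDeriv_genPoissonPGF_zero hlam.ne' m 0
  have h1 : deriv (genPoissonPGF lam m) 0 = genPoissonProb lam m 1 := by
    simpa using iteratedDeriv_genPoissonPGF_zero hlam.ne' m 1
  have h2 : deriv (deriv (genPoissonPGF lam m)) 0 = 2 * genPoissonProb lam m 2 := by
    simpa [iteratedDeriv_succ] using iteratedDeriv_genPoissonPGF_zero hlam.ne' m 2
  have hne : genPoissonPGF lam m 0 ≠ 0 := by
    rw [h0]
    exact (genPoissonProb_zero_pos hlam m).ne'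
  have h := (ha.deriv.differentiableAt.hasDerivAt.div ha.differentiableAt.hasDerivAt hne).deriv
  change deriv (deriv (genPoissonPGF lam m) / genPoissonPGF lam m) 0 = _
  rw [h, h0, h1, h2]
  ring

lemma not_isInfinitelyDivisible_genPoissonLaw {lam : ℝ} (hlam : 0 < lam) {m : ℕ} (hm : 1 ≤ m)
    (h : lam < m / 4) : ¬ IsInfinitelyDivisible (genPoissonLaw lam m) := by
  intro hid
  have := isProbabilityMeasure_genPoissonLaw hlam m
  have e0 := measureReal_genPoissonLaw_singleton hlam m 0
  have e1 := measureReal_genPoissonLaw_singleton hlam m 1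
  have e2 := measureReal_genPoissonLaw_singleton hlam m 2
  simp only [Nat.cast_zero, Nat.cast_one, Nat.cast_ofNat] at e0 e1 e2
  have hle := hid.sq_measureReal_one_le (genPoissonLaw_compl_range_natCast lam m) (by
    intro h0
    have := genPoissonProb_zero_pos hlam m
    rw [← e0, Measure.real, h0] at this
    simp at this)
  rw [e0, e1, e2] at hle
  exact absurd (two_mul_genPoissonProb_lt_sq hlam hm h) (not_lt.2 hle)

lemma exists_hasFPowerSeriesAt_logDeriv_genPoissonPGF {lam : ℝ} (hlam : 0 < lam) {m : ℕ}
    (hm : 1 ≤ m) (h : lam < m / 4) : ∃ r : ℕ → ℝ,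
    HasFPowerSeriesAt (logDeriv (genPoissonPGF lam m))
      (FormalMultilinearSeries.ofScalars ℝ r) 0 ∧ ∃ k, r k < 0 := by
  have ha := (hasFPowerSeriesOnBall_genPoissonPGF hlam.ne' m).analyticAt
  have hp0 := genPoissonProb_zero_pos hlam m
  have h0 : genPoissonPGF lam m 0 = genPoissonProb lam m 0 := by
    simpa using iteratedDeriv_genPoissonPGF_zero hlam.ne' m 0
  have hlog : AnalyticAt ℝ (logDeriv (genPoissonPGF lam m)) 0 :=
    ha.deriv.div ha (by rw [h0]; exact hp0.ne')
  -- The negative coefficient is r_1, the derivative of P'/P at 0.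
  refine ⟨_, hlog.hasFPowerSeriesAt, 1, ?_⟩
  rw [iteratedDeriv_one, deriv_logDeriv_genPoissonPGF_zero hlam, Nat.factorial_one, Nat.cast_one,
    div_one]
  exact div_neg_of_neg_of_pos (sub_neg.2 (two_mul_genPoissonProb_lt_sq hlam hm h)) (by positivity)

/-! ### A zero of the characteristic function, and the two cases -/

lemma exists_charFun_genPoissonLaw_eq_zero {m : ℕ} {x : Fin m → ℝ}
    (hx : IsOrderedLaguerreZeros m x) {lam : ℝ} (hlam : 0 < lam) {k : Fin m} (hk : x k / 4 ≤ lam) :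
    ∃ u : ℝ, charFun (genPoissonLaw lam m) u = 0 := by
  have hxk := hx.pos k
  -- Solves 2λ(1 - cos u) = x_k; the argument is at least -1 exactly when λ ≥ x_k/4.
  refine ⟨Real.arccos (1 - x k / (2 * lam)), ?_⟩
  have h2 : x k / (2 * lam) ≤ 2 := by
    rw [div_le_iff₀ (by positivity)]
    linarith
  have h0 : 0 < x k / (2 * lam) := by positivity
  rw [charFun_genPoissonLaw hlam, Real.cos_arccos (by linarith) (by linarith),
    show 2 * lam * (1 - (1 - x k / (2 * lam))) = x k by field_simp; ring, (hx.2 (x k)).2 ⟨k, rfl⟩]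
  simp

theorem theorem6p1 (m : ℕ) (hm : 1 ≤ m) :
    -- the zeros of `L_m` are real, simple and positive, so they can be listed as below
    (∃ x : Fin m → ℝ, IsOrderedLaguerreZeros m x ∧ ∀ k, 0 < x k) ∧
    -- for positive parameters the law is a probability law with the stated characteristic function
    (∀ lam : ℝ, 0 < lam →
      IsProbabilityMeasure (genPoissonLaw lam m) ∧
      ∀ u : ℝ, charFun (genPoissonLaw lam m) u =
        Complex.exp (lam * (Complex.exp (Complex.I * u) - 1)) *
          Complex.exp (Complex.I * m * u) *
            (((laguerre 0 m).eval (2 * lam * (1 - Real.cos u)) : ℝ) : ℂ)) ∧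
    ∀ x : Fin m → ℝ, IsOrderedLaguerreZeros m x → ∀ lam : ℝ,
      -- first case
      ((∃ k, x k / 4 ≤ lam) →
        ¬ IsInfinitelyDivisible (genPoissonLaw lam m) ∧
        ∃ u : ℝ, charFun (genPoissonLaw lam m) u = 0) ∧
      -- second case
      (0 < lam → lam < x ⟨0, hm⟩ / 4 →
        ¬ IsInfinitelyDivisible (genPoissonLaw lam m) ∧
        ∃ r : ℕ → ℝ,
          HasFPowerSeriesAt (logDeriv (genPoissonPGF lam m))
            (FormalMultilinearSeries.ofScalars ℝ r) 0 ∧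
          ∃ k, r k < 0) := by
  refine ⟨exists_isOrderedLaguerreZeros m, fun lam hlam =>
    ⟨isProbabilityMeasure_genPoissonLaw hlam m, charFun_genPoissonLaw hlam m⟩,
    fun x hx lam => ⟨?_, fun hlam hlt => ?_⟩⟩
  · rintro ⟨k, hk⟩
    have hlam : 0 < lam := by linarith [hx.pos k]
    have := isProbabilityMeasure_genPoissonLaw hlam m
    obtain ⟨u, hu⟩ := exists_charFun_genPoissonLaw_eq_zero hx hlam hk
    exact ⟨fun hid => hid.charFun_ne_zero u hu, u, hu⟩
  · have h : lam < m / 4 := by linarith [hx.first_le hm]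
    exact ⟨not_isInfinitelyDivisible_genPoissonLaw hlam hm h,
      exists_hasFPowerSeriesAt_logDeriv_genPoissonPGF hlam hm h⟩
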